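/- Setting. Let $d\ge 1$ and let $\mu>0$, $L$, $\tilde L$, $\rho$ be real numbers with $0<\rho<1-\frac{\mu}{dL}$; put $M:=\tilde L/\mu^{3/2}$. On $\mathbb R^d$ use the Euclidean inner product and norm, and for matrices the spectral norm and $\langle X,Y\rangle=\operatorname{Tr}(X^{\mathsf T}Y)$. For $f_1,\dots,f_n:\mathbb R^d\to\mathbb R$ ($n\ge1$) twice continuously differentiable, consider the assumptions, for all $x,y\in\mathbb R^d$ and all $i$: $$\tfrac{\mu}{2}\|y-x\|^2\le f_i(y)-f_i(x)-\langle\nabla f_i(x),y-x\rangle\le\tfrac L2\|y-x\|^2,\qquad \|\nabla^2f_i(y)-\nabla^2f_i(x)\|\le\tilde L\|y-x\|.\tag{A}$$ Let $x^\star$ be the minimizer of $\frac1n\sum_{i=1}^nf_i$. Write $\|y\|_{f,x}:=\sqrt{\langle y,\nabla^2f(x)y\rangle}$, $\sigma(B,K):=\langle K^{-1},B-K\rangle$, and $$\mathrm{BFGS}(B,K,u):=B-\frac{Buu^{\mathsf T}B}{\langle u,Bu\rangle}+\frac{Kuu^{\mathsf T}K}{\langle u,Ku\rangle}\ (u\ne0),\qquad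 \mathrm{BFGS}(B,K,0):=B.$$ A greedy vector $\bar u(B,K)$ is any maximizer of $\langle u,Bu\rangle/\langle u,Ku\rangle$ over the standard basis vectors $u\in\{e_1,\dots,e_d\}$ (ties are broken arbitrarily). SIQN. Start from $x^0\in\mathbb R^d$, $z_i^0=x^0$, and symmetric matrices $B_i^0\succeq\nabla^2f_i(x^0)$, $i=1,\dots,n$. For $t\ge1$ let $i_t=1+((t-1)\bmod n)$ and $$x^t=\Big(\sum_{i=1}^nB_i^{t-1}\Big)^{-1}\sum_{i=1}^n\big(B_i^{t-1}z_i^{t-1}-\nabla f_i(z_i^{t-1})\big).$$ Set $z_j^t=z_j^{t-1}$ and $B_j^t=B_j^{t-1}$ for $j\neq i_t$, and, writing $i=i_t$, set $z_i^t=x^t$ and $$\beta_t=\tfrac M2\|z_i^t-z_i^{t-1}\|_{f_i,z_i^{t-1}},\qquad K^t=\int_0^1\nabla^2f_i\big(z_i^{t-1}+\tau(z_i^t-z_i^{t-1})\big)\,d\tau,$$ $$Q^t=\mathrm{BFGS}\big((1+\beta_t)^2B_i^{t-1},(1+\beta_t)K^t,z_i^t-z_i^{t-1}\big),\qquad B_i^t=\mathrm{BFGS}\big(Q^t,\nabla^2f_i(z_i^t),\bar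 u(Q^t,\nabla^2f_i(z_i^t))\big).$$ Lemma (linear convergence of SIQN). There exist constants $\epsilon>0$ and $\sigma_0>0$, depending only on $d,\mu,L,\tilde L,\rho$, such that for every $n\ge1$, all $f_1,\dots,f_n$ satisfying (A), and every run of SIQN with $$\|x^0-x^\star\|\le\epsilon\quad\text{and}\quad\sigma(B_i^0,\nabla^2f_i(x^0))\le\sigma_0\ \text{ for all }i,$$ we have $$\|x^t-x^\star\|\le\rho^{\lceil t/n\rceil}\|x^0-x^\star\|\quad\text{for all }t\ge0,$$ and, for all $t\ge1$, $$\sigma\big(B_{i_t}^t,\nabla^2f_{i_t}(z_{i_t}^t)\big)\le\Big(1-\frac{\mu}{dL}\Big)^{\lceil t/n\rceil}\delta,\qquad \delta:=e^{\frac{4M\sqrt L\,\epsilon}{1-\rho}}\Bigg(\sigma_0+\epsilon\,\frac{4Md\sqrt L}{1-\frac{\rho}{1-\frac{\mu}{dL}}}\Bigg).$$ -/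

import Mathlib

open scoped Matrix

noncomputable section

namespace SIQN

/-- The space `ℝ^d` with the Euclidean norm. -/
abbrev Vec (d : ℕ) : Type := EuclideanSpace ℝ (Fin d)

/-- Real `d × d` matrices. -/
abbrev Mat (d : ℕ) : Type := Matrix (Fin d) (Fin d) ℝ

/-- The spectral norm of a matrix: its operator norm with respect to the Euclidean norm. -/
def specNorm {d : ℕ} (A : Mat d) : ℝ :=
  ‖Matrix.toEuclideanCLM (n := Fin d) (𝕜 := ℝ) A‖

/-- The Hessian matrix of `f` at `x`; its `(i, j)` entry is `∂ᵢ ∂ⱼ f (x)`. -/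
def hess {d : ℕ} (f : Vec d → ℝ) (x : Vec d) : Mat d :=
  Matrix.of fun i j =>
    fderiv ℝ (fun y => fderiv ℝ f y) x (EuclideanSpace.single i 1) (EuclideanSpace.single j 1)

/-- The averaged Hessian `∫₀¹ ∇²f (x + τ (y - x)) dτ`, entrywise. -/
def avgHess {d : ℕ} (f : Vec d → ℝ) (x y : Vec d) : Mat d :=
  Matrix.of fun i j => ∫ τ in (0 : ℝ)..1, hess f (x + τ • (y - x)) i j

/-- `μ`-strong convexity of a differentiable function. -/
def StronglyConvex {d : ℕ} (μ : ℝ) (f : Vec d → ℝ) : Prop :=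
  ∀ x y : Vec d, μ / 2 * ‖y - x‖ ^ 2 ≤ f y - f x - inner ℝ (gradient f x) (y - x)

/-- `L`-smoothness of a differentiable function. -/
def Smooth {d : ℕ} (L : ℝ) (f : Vec d → ℝ) : Prop :=
  ∀ x y : Vec d, f y - f x - inner ℝ (gradient f x) (y - x) ≤ L / 2 * ‖y - x‖ ^ 2

/-- The Hessian of `f` is Lipschitz continuous with constant `Lt` in the spectral norm. -/
def HessLipschitz {d : ℕ} (Lt : ℝ) (f : Vec d → ℝ) : Prop :=
  ∀ x y : Vec d, specNorm (hess f y - hess f x) ≤ Lt * ‖y - x‖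

/-- The local norm `‖y‖_x = √⟨y, ∇²f(x) y⟩`. -/
def localNorm {d : ℕ} (f : Vec d → ℝ) (x y : Vec d) : ℝ :=
  Real.sqrt (y.ofLp ⬝ᵥ (hess f x *ᵥ y.ofLp))

/-- The generalized BFGS update
`B - (B u uᵀ B) / ⟨u, B u⟩ + (K u uᵀ K) / ⟨u, K u⟩`; for `u = 0` it leaves `B` unchanged. -/
def bfgs {d : ℕ} (B K : Mat d) (u : Fin d → ℝ) : Mat d :=
  B - (u ⬝ᵥ (B *ᵥ u))⁻¹ • (B * Matrix.vecMulVec u u * B)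
    + (u ⬝ᵥ (K *ᵥ u))⁻¹ • (K * Matrix.vecMulVec u u * K)

/-- The `k`-th standard basis vector. -/
def stdVec {d : ℕ} (k : Fin d) : Fin d → ℝ := Pi.single k 1

/-- `u` is a greedy vector for the pair `(B, K)`: it maximizes `⟨u, B u⟩ / ⟨u, K u⟩` among the
standard basis vectors. Any choice among several maximizers is allowed. -/
def IsGreedy {d : ℕ} (B K : Mat d) (u : Fin d → ℝ) : Prop :=
  ∃ k : Fin d, u = stdVec k ∧ ∀ j : Fin d,
    (stdVec j ⬝ᵥ (B *ᵥ stdVec j)) / (stdVec j ⬝ᵥ (K *ᵥ stdVec j))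
      ≤ (u ⬝ᵥ (B *ᵥ u)) / (u ⬝ᵥ (K *ᵥ u))

/-- The approximation error `σ(B, K) = ⟨K⁻¹, B - K⟩`, where `⟨X, Y⟩ = Tr (Xᵀ Y)`. -/
def sigma {d : ℕ} (B K : Mat d) : ℝ := Matrix.trace ((K⁻¹)ᵀ * (B - K))

/-- The strong self-concordance constant `M = Lt / μ^(3/2)`. -/
def concM (μ Lt : ℝ) : ℝ := Lt / μ ^ ((3 : ℝ) / 2)

/-- The component treated at iteration `t ≥ 1`: `(t - 1) mod n`, components being numbered
`0, …, n - 1`. -/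
def idx (n : ℕ) [NeZero n] (t : ℕ) : Fin n := Fin.ofNat n (t - 1)

/-- The vector `(∑ᵢ Bᵢ)⁻¹ (∑ᵢ (Bᵢ zᵢ - ∇fᵢ(zᵢ)))`. -/
def newIterate {d n : ℕ} (f : Fin n → Vec d → ℝ) (z : Fin n → Vec d) (B : Fin n → Mat d) :
    Vec d :=
  WithLp.toLp 2 ((∑ i, B i)⁻¹ *ᵥ
    ∑ i, (B i *ᵥ (z i).ofLp - (gradient (f i) (z i)).ofLp))

/-- The scaling factor `β = (M / 2) ‖z' - z‖_z`. -/
def beta {d : ℕ} (M : ℝ) (f : Vec d → ℝ) (z z' : Vec d) : ℝ := M / 2 * localNorm f z (z' - z)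

/-- The matrix after the (scaled) classic BFGS update, when the point moves from `z` to `z'`:
`BFGS ((1 + β)² B, (1 + β) K, z' - z)`. -/
def classicUpdate {d : ℕ} (M : ℝ) (f : Vec d → ℝ) (B : Mat d) (z z' : Vec d) : Mat d :=
  bfgs ((1 + beta M f z z') ^ 2 • B) ((1 + beta M f z z') • avgHess f z z') (z' - z).ofLp

/-- `x t`, `z t i`, `B t i` are the iterates, the memorized points and the Hessian approximations
of a run of SIQN on `f 0, …, f (n - 1)`, with scaling parameter `M`, started from `x 0` and
`B 0`. -/
structure IsRun {d n : ℕ} [NeZero n] (M : ℝ) (f : Fin n → Vec d → ℝ)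
    (x : ℕ → Vec d) (z : ℕ → Fin n → Vec d) (B : ℕ → Fin n → Mat d) : Prop where
  init_z : ∀ i, z 0 i = x 0
  init_B : ∀ i, (B 0 i - hess (f i) (x 0)).PosSemidef
  step_x : ∀ t, x (t + 1) = newIterate f (z t) (B t)
  step_z : ∀ t, z (t + 1) (idx n (t + 1)) = x (t + 1)
  step_z_other : ∀ t i, i ≠ idx n (t + 1) → z (t + 1) i = z t i
  step_B : ∀ t, ∃ Q : Mat d, ∃ u : Fin d → ℝ,
    Q = classicUpdate M (f (idx n (t + 1))) (B t (idx n (t + 1)))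
      (z t (idx n (t + 1))) (z (t + 1) (idx n (t + 1))) ∧
    IsGreedy Q (hess (f (idx n (t + 1))) (z (t + 1) (idx n (t + 1)))) u ∧
    B (t + 1) (idx n (t + 1)) =
      bfgs Q (hess (f (idx n (t + 1))) (z (t + 1) (idx n (t + 1)))) u
  step_B_other : ∀ t i, i ≠ idx n (t + 1) → B (t + 1) i = B t i

/-- The constant
`δ = exp (4 M √L ε / (1 - ρ)) (σ₀ + ε · 4 M d √L / (1 - ρ / (1 - μ / (d L))))`. -/
def delta (d : ℕ) (μ L Lt ρ ε σ₀ : ℝ) : ℝ :=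
  Real.exp (4 * concM μ Lt * Real.sqrt L * ε / (1 - ρ)) *
    (σ₀ + ε * (4 * concM μ Lt * d * Real.sqrt L / (1 - ρ / (1 - μ / (d * L)))))

end SIQN

end

open scoped Matrix

/-! One induction controls the distances and the Hessian errors together. The gradients at x⋆ sum to
zero, so (∑ Bᵢ)(x⁺ - x⋆) is the sum of the residuals Bᵢ(zᵢ - x⋆) - (∇fᵢ(zᵢ) - ∇fᵢ(x⋆)), each of norm
at most (Lσᵢ + L̃/2 ‖zᵢ - x⋆‖)‖zᵢ - x⋆‖ (`norm_residual_le`). Since ∑ Bᵢ ⪰ nμ I, the new iterate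
gains a factor ρ over the bound for the least recently updated point whenever all σᵢ ≤ δ and Lδ +
L̃ε/2 ≤ ρμ (`norm_newIterate_sub_le`). The last inequality is arranged by shrinking ε and σ₀,
because δ tends to 0 with them (`exists_radius`).

For the Hessian errors, the scaled classic update keeps the approximation above the new Hessian and
raises σ + d at most by the factor (1+β)⁴ (`sigma_bfgs_smul_le`); the greedy update then multiplies
σ by at most a = 1 - μ/(dL) (`sigma_bfgs_greedy_le`). At the (k+1)-st update of a component β is
O(ρᵏ), so the factors (1+β)⁴ multiply to a bounded exponential, and the errors injected through d,
normalized by aᵏ, form a geometric series of ratio ρ/a < 1 (`errBound_step`). This produces δ.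
Distances need σ ≤ δ and σ needs decaying distances; `IsRun.invariant` carries both along, indexed
by the number of updates of each component. -/

namespace SIQN

/-! ### Loewner order, inverses and traces. -/

section LinearAlgebra

variable {ι : Type*} [Fintype ι]

theorem dotProduct_mulVec_comm {A : Matrix ι ι ℝ} (hA : A.IsHermitian) (v w : ι → ℝ) :
    v ⬝ᵥ (A *ᵥ w) = w ⬝ᵥ (A *ᵥ v) := by
  have h : Aᵀ = A := by simpa [Matrix.IsHermitian] using hA
  rw [Matrix.dotProduct_mulVec, ← Matrix.mulVec_transpose, h, dotProduct_comm]

theorem _root_.Matrix.PosSemidef.dotProduct_nonneg {A : Matrix ι ι ℝ} (hA : A.PosSemidef)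
    (v : ι → ℝ) : 0 ≤ v ⬝ᵥ (A *ᵥ v) := by
  simpa using hA.dotProduct_mulVec_nonneg v

theorem _root_.Matrix.PosDef.dotProduct_pos {A : Matrix ι ι ℝ} (hA : A.PosDef)
    {v : ι → ℝ} (hv : v ≠ 0) : 0 < v ⬝ᵥ (A *ᵥ v) := by
  simpa using hA.dotProduct_mulVec_pos hv

/-- The Cauchy–Schwarz inequality for a positive semidefinite form. -/
theorem dotProduct_mulVec_sq_le {A : Matrix ι ι ℝ} (hA : A.PosSemidef) (v w : ι → ℝ) :
    (v ⬝ᵥ (A *ᵥ w)) ^ 2 ≤ (v ⬝ᵥ (A *ᵥ v)) * (w ⬝ᵥ (A *ᵥ w)) := by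
  have key : ∀ t : ℝ, 0 ≤ (w ⬝ᵥ (A *ᵥ w)) * (t * t) + (2 * (v ⬝ᵥ (A *ᵥ w))) * t
      + v ⬝ᵥ (A *ᵥ v) := by
    intro t
    have h := hA.dotProduct_nonneg (v + t • w)
    simp only [Matrix.mulVec_add, Matrix.mulVec_smul, dotProduct_add, add_dotProduct,
      smul_dotProduct, dotProduct_smul, smul_eq_mul,
      dotProduct_mulVec_comm hA.isHermitian w v] at h
    linarith
  -- A real quadratic that is nowhere negative has nonpositive discriminant.
  have h := discrim_le_zero key
  unfold discrim at h
  nlinarith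

theorem posSemidef_sub_iff {A B : Matrix ι ι ℝ} (hA : A.IsHermitian) (hB : B.IsHermitian) :
    (A - B).PosSemidef ↔ ∀ v, v ⬝ᵥ (B *ᵥ v) ≤ v ⬝ᵥ (A *ᵥ v) := by
  simp only [Matrix.posSemidef_iff_dotProduct_mulVec, hA.sub hB, true_and, star_trivial,
    Matrix.sub_mulVec, dotProduct_sub, sub_nonneg]

theorem posDef_of_sub {κ : Type*} {A B : Matrix κ κ ℝ} (hB : B.PosDef) (h : (A - B).PosSemidef) :
    A.PosDef := by
  simpa using Matrix.PosDef.posSemidef_add h hB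

theorem isHermitian_smul_real {κ : Type*} {A : Matrix κ κ ℝ} (hA : A.IsHermitian) (c : ℝ) :
    (c • A).IsHermitian := by
  unfold Matrix.IsHermitian at *
  rw [Matrix.conjTranspose_smul, hA, star_trivial]

variable [DecidableEq ι]

theorem mulVec_inv_mulVec {A : Matrix ι ι ℝ} (hA : A.PosDef) (v : ι → ℝ) :
    A *ᵥ (A⁻¹ *ᵥ v) = v := by
  have h : IsUnit A.det := (Matrix.isUnit_iff_isUnit_det A).mp hA.isUnit
  rw [Matrix.mulVec_mulVec, Matrix.mul_nonsing_inv _ h, Matrix.one_mulVec]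

theorem inv_mulVec_mulVec {A : Matrix ι ι ℝ} (hA : A.PosDef) (v : ι → ℝ) :
    A⁻¹ *ᵥ (A *ᵥ v) = v := by
  have h : IsUnit A.det := (Matrix.isUnit_iff_isUnit_det A).mp hA.isUnit
  rw [Matrix.mulVec_mulVec, Matrix.nonsing_inv_mul _ h, Matrix.one_mulVec]

theorem dotProduct_sq_le_inv {K : Matrix ι ι ℝ} (hK : K.PosDef) (x y : ι → ℝ) :
    (x ⬝ᵥ y) ^ 2 ≤ (x ⬝ᵥ (K *ᵥ x)) * (y ⬝ᵥ (K⁻¹ *ᵥ y)) := by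
  have h := dotProduct_mulVec_sq_le hK.posSemidef x (K⁻¹ *ᵥ y)
  rw [mulVec_inv_mulVec hK] at h
  rwa [dotProduct_comm (K⁻¹ *ᵥ y)] at h

/-- Inversion reverses the Loewner order. -/
theorem posSemidef_smul_inv_sub_inv {K H : Matrix ι ι ℝ} (hK : K.PosDef) (hH : H.PosDef)
    {c : ℝ} (h : ∀ v, v ⬝ᵥ (K *ᵥ v) ≤ c * (v ⬝ᵥ (H *ᵥ v))) :
    (c • K⁻¹ - H⁻¹).PosSemidef := by
  rw [posSemidef_sub_iff (isHermitian_smul_real hK.inv.isHermitian c) hH.inv.isHermitian]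
  intro y
  rw [Matrix.smul_mulVec, dotProduct_smul, smul_eq_mul]
  have h1 := dotProduct_sq_le_inv hK (H⁻¹ *ᵥ y) y
  have h2 := h (H⁻¹ *ᵥ y)
  rw [mulVec_inv_mulVec hH] at h2
  rw [dotProduct_comm (H⁻¹ *ᵥ y) y] at h1 h2
  have h3 := hK.inv.posSemidef.dotProduct_nonneg y
  have h4 := hH.inv.posSemidef.dotProduct_nonneg y
  rcases h4.eq_or_lt with h0 | hpos
  · rcases eq_or_ne y 0 with rfl | hy
    · simp
    · exact absurd h0 (hH.inv.dotProduct_pos hy).ne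
  · have h5 : (y ⬝ᵥ (H⁻¹ *ᵥ y)) ^ 2 ≤
        (c * (y ⬝ᵥ (H⁻¹ *ᵥ y))) * (y ⬝ᵥ (K⁻¹ *ᵥ y)) :=
      h1.trans (mul_le_mul_of_nonneg_right h2 h3)
    nlinarith

/-- Factor A = CᴴC and cycle the trace: it becomes the trace of C B Cᴴ, which is positive
semidefinite. -/
theorem trace_mul_nonneg_of_posSemidef {A B : Matrix ι ι ℝ} (hA : A.PosSemidef)
    (hB : B.PosSemidef) : 0 ≤ (A * B).trace := by
  open scoped MatrixOrder in
  obtain ⟨C, rfl⟩ := CStarAlgebra.nonneg_iff_eq_star_mul_self.mp hA.nonneg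
  have h := (hB.mul_mul_conjTranspose_same C).trace_nonneg
  rwa [Matrix.trace_mul_comm, ← Matrix.mul_assoc] at h

theorem trace_mul_le_of_sub {A B C : Matrix ι ι ℝ} (h : (A - B).PosSemidef)
    (hC : C.PosSemidef) : (B * C).trace ≤ (A * C).trace := by
  have := trace_mul_nonneg_of_posSemidef h hC
  rw [Matrix.sub_mul, Matrix.trace_sub] at this
  linarith

theorem sq_entry_le {C : Matrix ι ι ℝ} (hC : C.PosSemidef) (i j : ι) :
    C i j ^ 2 ≤ C i i * C j j := by
  simpa using dotProduct_mulVec_sq_le hC (Pi.single i 1) (Pi.single j 1)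

/-- The spectral norm of a positive semidefinite matrix is at most its trace. -/
theorem mulVec_dotProduct_self_le {C : Matrix ι ι ℝ} (hC : C.PosSemidef) (v : ι → ℝ) :
    (C *ᵥ v) ⬝ᵥ (C *ᵥ v) ≤ C.trace ^ 2 * (v ⬝ᵥ v) := by
  have h : ∀ i, (C *ᵥ v) i * (C *ᵥ v) i ≤ (C i i * C.trace) * (v ⬝ᵥ v) := by
    intro i
    have h1 := Finset.sum_mul_sq_le_sq_mul_sq Finset.univ (C i) v
    have h2 : ∑ j, C i j ^ 2 ≤ C i i * C.trace := by
      rw [Matrix.trace, Finset.mul_sum]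
      exact Finset.sum_le_sum fun j _ => sq_entry_le hC i j
    have h3 : (v ⬝ᵥ v) = ∑ j, v j ^ 2 := by simp [dotProduct, sq]
    rw [h3, ← sq]
    exact h1.trans (mul_le_mul_of_nonneg_right h2 (Finset.sum_nonneg fun _ _ => sq_nonneg _))
  calc (C *ᵥ v) ⬝ᵥ (C *ᵥ v) ≤ ∑ i, (C i i * C.trace) * (v ⬝ᵥ v) :=
        Finset.sum_le_sum fun i _ => h i
    _ = C.trace ^ 2 * (v ⬝ᵥ v) := by
        rw [← Finset.sum_mul, ← Finset.sum_mul, sq]; rfl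

end LinearAlgebra

/-! ### Effect of BFGS updates on the Loewner order and on σ. -/

section Update

variable {d : ℕ}

theorem bfgs_zero (B K : Mat d) : bfgs B K 0 = B := by
  simp [bfgs]

theorem dotProduct_mul_vecMulVec_mul {A : Mat d} (hA : A.IsHermitian) (u v : Fin d → ℝ) :
    v ⬝ᵥ ((A * Matrix.vecMulVec u u * A) *ᵥ v) = (v ⬝ᵥ (A *ᵥ u)) ^ 2 := by
  rw [← Matrix.mulVec_mulVec, ← Matrix.mulVec_mulVec, Matrix.vecMulVec_mulVec,
    ← dotProduct_mulVec_comm hA v u]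
  simp [Matrix.mulVec_smul, sq]

theorem isHermitian_mul_vecMulVec_mul {A : Mat d} (hA : A.IsHermitian) (u : Fin d → ℝ) :
    (A * Matrix.vecMulVec u u * A).IsHermitian := by
  have h : Aᵀ = A := by simpa [Matrix.IsHermitian] using hA
  simp [Matrix.IsHermitian, h, Matrix.mul_assoc, Matrix.transpose_vecMulVec]

theorem isHermitian_bfgs {B K : Mat d} (hB : B.IsHermitian) (hK : K.IsHermitian)
    (u : Fin d → ℝ) : (bfgs B K u).IsHermitian :=
  (hB.sub (isHermitian_smul_real (isHermitian_mul_vecMulVec_mul hB u) _)).add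
    (isHermitian_smul_real (isHermitian_mul_vecMulVec_mul hK u) _)

/-- Convexity of the quadratic-over-linear function, (b+c)²/(a+e) ≤ b²/a + c²/e, with c²/e replaced
by a bound w so that e = 0 is allowed. It serves with a = ⟨u,Ku⟩ and e = ⟨u,(B-K)u⟩, which may
vanish. -/
theorem add_sq_div_add_le {a b c e w : ℝ} (ha : 0 < a) (he : 0 ≤ e) (hw : 0 ≤ w)
    (h : c ^ 2 ≤ e * w) : (a + e)⁻¹ * (b + c) ^ 2 ≤ a⁻¹ * b ^ 2 + w := by
  obtain ⟨p, hp, hpb⟩ : ∃ p, a⁻¹ * b ^ 2 = p ∧ b ^ 2 = a * p :=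
    ⟨_, rfl, (mul_inv_cancel_left₀ ha.ne' _).symm⟩
  have hp0 : 0 ≤ p := hp ▸ by positivity
  -- AM-GM: (2bc)² ≤ 4(aw)(ep) ≤ (aw + ep)².
  have hs : 2 * b * c ≤ a * w + e * p := by
    refine (abs_le_of_sq_le_sq' ?_ (by positivity)).2
    have h1 : b ^ 2 * c ^ 2 ≤ a * p * (e * w) := by
      rw [hpb]; exact mul_le_mul_of_nonneg_left h (by positivity)
    nlinarith [sq_nonneg (a * w - e * p)]
  rw [hp, ← div_eq_inv_mul, div_le_iff₀ (by positivity)]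
  nlinarith

/-- A BFGS update of `B ⪰ K` towards `K` stays above `K`. -/
theorem posSemidef_bfgs_sub {B K : Mat d} (hK : K.PosDef) (hBK : (B - K).PosSemidef)
    (u : Fin d → ℝ) : (bfgs B K u - K).PosSemidef := by
  rcases eq_or_ne u 0 with rfl | hu
  · rwa [bfgs_zero]
  have hB := posDef_of_sub hK hBK
  rw [posSemidef_sub_iff (isHermitian_bfgs hB.isHermitian hK.isHermitian u) hK.isHermitian]
  intro v
  have e1 := dotProduct_mul_vecMulVec_mul hB.isHermitian u v
  have e2 := dotProduct_mul_vecMulVec_mul hK.isHermitian u v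
  have h1 := dotProduct_mulVec_sq_le hBK v u
  have h2 := hBK.dotProduct_nonneg u
  have h3 := hBK.dotProduct_nonneg v
  simp only [Matrix.sub_mulVec, dotProduct_sub] at h1 h2 h3
  have h := add_sq_div_add_le (b := v ⬝ᵥ (K *ᵥ u)) (hK.dotProduct_pos hu) h2 h3
    (h1.trans_eq (mul_comm _ _))
  simp only [bfgs, Matrix.add_mulVec, Matrix.sub_mulVec, Matrix.smul_mulVec, dotProduct_add,
    dotProduct_sub, dotProduct_smul, smul_eq_mul, e1, e2]
  simp only [add_sub_cancel] at h
  linarith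

theorem trace_mul_mul_vecMulVec_mul (P : Mat d) {A : Mat d} (hA : A.IsHermitian)
    (u : Fin d → ℝ) :
    (P * (A * Matrix.vecMulVec u u * A)).trace = (A *ᵥ u) ⬝ᵥ (P *ᵥ (A *ᵥ u)) := by
  have h : Aᵀ = A := by simpa [Matrix.IsHermitian] using hA
  rw [Matrix.mul_vecMulVec, Matrix.vecMulVec_mul, Matrix.mul_vecMulVec, Matrix.trace_vecMulVec,
    ← Matrix.mulVec_transpose, h, dotProduct_comm]

/-- The added rank-one term contributes exactly 1, since ⟨Ku, K⁻¹Ku⟩ = ⟨u, Ku⟩. -/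
theorem trace_inv_mul_bfgs {B K : Mat d} (hB : B.IsHermitian) (hK : K.PosDef)
    {u : Fin d → ℝ} (hu : u ≠ 0) :
    (K⁻¹ * bfgs B K u).trace = (K⁻¹ * B).trace
      - (u ⬝ᵥ (B *ᵥ u))⁻¹ * ((B *ᵥ u) ⬝ᵥ (K⁻¹ *ᵥ (B *ᵥ u))) + 1 := by
  have hpos := hK.dotProduct_pos hu
  rw [bfgs, Matrix.mul_add, Matrix.mul_sub, Matrix.trace_add, Matrix.trace_sub,
    Matrix.mul_smul, Matrix.mul_smul, Matrix.trace_smul, Matrix.trace_smul,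
    trace_mul_mul_vecMulVec_mul _ hB, trace_mul_mul_vecMulVec_mul _ hK.isHermitian,
    inv_mulVec_mulVec hK, dotProduct_comm (K *ᵥ u), smul_eq_mul, smul_eq_mul,
    inv_mul_cancel₀ hpos.ne']

/-- A BFGS update decreases the trace by at least the relative error in the direction `u`. -/
theorem trace_inv_mul_bfgs_le {B K : Mat d} (hK : K.PosDef) (hBK : (B - K).PosSemidef)
    {u : Fin d → ℝ} (hu : u ≠ 0) :
    (K⁻¹ * bfgs B K u).trace ≤ (K⁻¹ * B).trace
      - ((u ⬝ᵥ (B *ᵥ u)) / (u ⬝ᵥ (K *ᵥ u)) - 1) := by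
  have hB := posDef_of_sub hK hBK
  rw [trace_inv_mul_bfgs hB.isHermitian hK hu]
  have h1 := hK.dotProduct_pos hu
  have h2 := hB.dotProduct_pos hu
  have h3 := dotProduct_sq_le_inv hK u (B *ᵥ u)
  have h4 : (u ⬝ᵥ (B *ᵥ u)) / (u ⬝ᵥ (K *ᵥ u)) ≤
      (u ⬝ᵥ (B *ᵥ u))⁻¹ * ((B *ᵥ u) ⬝ᵥ (K⁻¹ *ᵥ (B *ᵥ u))) := by
    rw [div_le_iff₀ h1, ← div_eq_inv_mul, div_mul_eq_mul_div, le_div_iff₀ h2]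
    linarith
  linarith

theorem trace_inv_mul_bfgs_le_self {B K : Mat d} (hK : K.PosDef) (hBK : (B - K).PosSemidef)
    (u : Fin d → ℝ) : (K⁻¹ * bfgs B K u).trace ≤ (K⁻¹ * B).trace := by
  rcases eq_or_ne u 0 with rfl | hu
  · rw [bfgs_zero]
  have h := trace_inv_mul_bfgs_le hK hBK hu
  have h1 := hBK.dotProduct_nonneg u
  rw [Matrix.sub_mulVec, dotProduct_sub, sub_nonneg, ← one_le_div (hK.dotProduct_pos hu)] at h1
  linarith

theorem sigma_eq {B K : Mat d} (hK : K.PosDef) : sigma B K = (K⁻¹ * B).trace - d := by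
  have h : (K⁻¹)ᵀ = K⁻¹ := by simpa [Matrix.IsHermitian] using hK.inv.isHermitian
  rw [sigma, h, Matrix.mul_sub, Matrix.trace_sub,
    Matrix.nonsing_inv_mul _ ((Matrix.isUnit_iff_isUnit_det K).mp hK.isUnit)]
  simp

theorem sigma_nonneg {B K : Mat d} (hK : K.PosDef) (h : (B - K).PosSemidef) :
    0 ≤ sigma B K := by
  have e : (K⁻¹)ᵀ = K⁻¹ := by simpa [Matrix.IsHermitian] using hK.inv.isHermitian
  rw [sigma, e]
  exact trace_mul_nonneg_of_posSemidef hK.inv.posSemidef h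

theorem posDef_of_le {H : Mat d} (hH : H.IsHermitian) {μ : ℝ} (hμ : 0 < μ)
    (h : ∀ v, μ * (v ⬝ᵥ v) ≤ v ⬝ᵥ (H *ᵥ v)) : H.PosDef := by
  refine Matrix.PosDef.of_dotProduct_mulVec_pos hH fun v hv => ?_
  have h1 : 0 < v ⬝ᵥ v := by
    have := (Matrix.PosDef.one (n := Fin d) (R := ℝ)).dotProduct_pos hv
    simpa using this
  simpa using (mul_pos hμ h1).trans_le (h v)

/-- From H ⪯ L I follows I ⪯ L H⁻¹; take the trace against B - H ⪰ 0. This turns σ into a bound on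
the size of B - H. -/
theorem trace_sub_le_sigma {B H : Mat d} {L : ℝ} (hH : H.PosDef)
    (hHL : ∀ v, v ⬝ᵥ (H *ᵥ v) ≤ L * (v ⬝ᵥ v)) (hBH : (B - H).PosSemidef) :
    (B - H).trace ≤ L * sigma B H := by
  have h1 : (L • H⁻¹ - (1 : Mat d)⁻¹).PosSemidef :=
    posSemidef_smul_inv_sub_inv hH Matrix.PosDef.one (by simpa using hHL)
  have h2 := trace_mul_le_of_sub h1 hBH
  have e : (H⁻¹)ᵀ = H⁻¹ := by simpa [Matrix.IsHermitian] using hH.inv.isHermitian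
  rw [sigma, e]
  simpa using h2

theorem sigma_le_trace_sub {B H : Mat d} {μ : ℝ} (hμ : 0 < μ) (hH : H.PosDef)
    (hHμ : ∀ v, μ * (v ⬝ᵥ v) ≤ v ⬝ᵥ (H *ᵥ v)) (hBH : (B - H).PosSemidef) :
    sigma B H ≤ μ⁻¹ * (B - H).trace := by
  have h1 : (μ⁻¹ • (1 : Mat d)⁻¹ - H⁻¹).PosSemidef :=
    posSemidef_smul_inv_sub_inv Matrix.PosDef.one hH fun v => by
      rw [Matrix.one_mulVec, ← div_eq_inv_mul, le_div_iff₀ hμ, mul_comm]; exact hHμ v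
  have h2 := trace_mul_le_of_sub h1 hBH
  have e : (H⁻¹)ᵀ = H⁻¹ := by simpa [Matrix.IsHermitian] using hH.inv.isHermitian
  rw [sigma, e]
  simpa using h2

/-- The greedy BFGS update contracts the approximation error. -/
theorem sigma_bfgs_greedy_le {Q H : Mat d} {μ L : ℝ} (hμ : 0 < μ) (hL : 0 < L)
    (hd : 0 < d) (hH : H.IsHermitian) (hHμ : ∀ v, μ * (v ⬝ᵥ v) ≤ v ⬝ᵥ (H *ᵥ v))
    (hHL : ∀ v, v ⬝ᵥ (H *ᵥ v) ≤ L * (v ⬝ᵥ v)) (hQH : (Q - H).PosSemidef)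
    {u : Fin d → ℝ} (hu : IsGreedy Q H u) :
    sigma (bfgs Q H u) H ≤ (1 - μ / (d * L)) * sigma Q H := by
  have hHpd := posDef_of_le hH hμ hHμ
  obtain ⟨k, rfl, hk⟩ := hu
  have hne : ∀ j : Fin d, stdVec j ≠ 0 := fun j => by simp [stdVec]
  have hd' : (0 : ℝ) < d := by exact_mod_cast hd
  set r := (stdVec k ⬝ᵥ (Q *ᵥ stdVec k)) / (stdVec k ⬝ᵥ (H *ᵥ stdVec k)) with hr
  have h1 := trace_inv_mul_bfgs_le hHpd hQH (hne k)
  have hr1 : 1 ≤ r := by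
    rw [hr, one_le_div (hHpd.dotProduct_pos (hne k))]
    have := hQH.dotProduct_nonneg (stdVec k)
    rw [Matrix.sub_mulVec, dotProduct_sub] at this
    linarith
  -- By greediness no basis vector has quotient above r, so each diagonal entry of Q - H is at most
  -- (r-1)⟨eⱼ, H eⱼ⟩ ≤ L(r-1). The maximal quotient therefore controls the whole trace.
  have h2 : (Q - H).trace ≤ d * (L * (r - 1)) := by
    have : ∀ j ∈ Finset.univ, (Q - H).diag j ≤ L * (r - 1) := by
      intro j _
      have hp := hHpd.dotProduct_pos (hne j)
      have h3 := hk j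
      rw [div_le_iff₀ hp] at h3
      have h4 := hHL (stdVec j)
      have h5 : (r - 1) * (stdVec j ⬝ᵥ (H *ᵥ stdVec j)) ≤ (r - 1) * (L * (stdVec j ⬝ᵥ stdVec j)) :=
        mul_le_mul_of_nonneg_left h4 (by linarith)
      simp [stdVec] at h3 h5 ⊢
      linarith
    simpa [Matrix.trace] using Finset.sum_le_sum this
  have h3 := sigma_le_trace_sub hμ hHpd hHμ hQH
  have h4 : μ / (d * L) * sigma Q H ≤ r - 1 := by
    calc μ / (d * L) * sigma Q H ≤ μ / (d * L) * (μ⁻¹ * (d * (L * (r - 1)))) := by 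
          gcongr
          exact h3.trans (by gcongr)
      _ = r - 1 := by field_simp
  rw [sigma_eq hHpd] at h4 ⊢
  rw [sigma_eq hHpd]
  linarith

/-- The error after the scaled classic BFGS update, measured in the new metric `H'`. -/
theorem sigma_bfgs_smul_le {B H H' K : Mat d} {b : ℝ} (hb : 0 ≤ b) (hH : H.PosDef)
    (hH' : H'.PosDef) (hK : K.PosDef) (hBH : (B - H).PosSemidef)
    (h1 : ∀ v, v ⬝ᵥ (K *ᵥ v) ≤ (1 + b) * (v ⬝ᵥ (H *ᵥ v)))
    (h2 : ∀ v, v ⬝ᵥ (H *ᵥ v) ≤ (1 + b) * (v ⬝ᵥ (K *ᵥ v)))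
    (h3 : ∀ v, v ⬝ᵥ (H' *ᵥ v) ≤ (1 + b) * (v ⬝ᵥ (K *ᵥ v)))
    (h4 : ∀ v, v ⬝ᵥ (K *ᵥ v) ≤ (1 + b) * (v ⬝ᵥ (H' *ᵥ v))) (u : Fin d → ℝ) :
    (bfgs ((1 + b) ^ 2 • B) ((1 + b) • K) u - H').PosSemidef ∧
      sigma (bfgs ((1 + b) ^ 2 • B) ((1 + b) • K) u) H' + d
        ≤ (1 + b) ^ 4 * (sigma B H + d) := by
  have hc : 0 < 1 + b := by linarith
  have hB := posDef_of_sub hH hBH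
  have hcK : ((1 + b) • K).PosDef := hK.smul hc
  -- The chain is (1+b)²B ⪰ (1+b)²H ⪰ (1+b)K: the scaling restores the order that the move may have
  -- broken.
  have hle : ((1 + b) ^ 2 • B - (1 + b) • K).PosSemidef := by
    rw [posSemidef_sub_iff (isHermitian_smul_real hB.isHermitian _) hcK.isHermitian]
    intro v
    have := hBH.dotProduct_nonneg v
    simp only [Matrix.sub_mulVec, dotProduct_sub, Matrix.smul_mulVec, dotProduct_smul,
      smul_eq_mul] at this ⊢
    have h5 : (1 + b) * (v ⬝ᵥ (K *ᵥ v)) ≤ (1 + b) * ((1 + b) * (v ⬝ᵥ (H *ᵥ v))) :=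
      mul_le_mul_of_nonneg_left (h1 v) hc.le
    have h6 : (1 + b) ^ 2 * (v ⬝ᵥ (H *ᵥ v)) ≤ (1 + b) ^ 2 * (v ⬝ᵥ (B *ᵥ v)) :=
      mul_le_mul_of_nonneg_left (by linarith) (by positivity)
    linarith
  set Q := bfgs ((1 + b) ^ 2 • B) ((1 + b) • K) u with hQ
  have hQK : (Q - (1 + b) • K).PosSemidef := posSemidef_bfgs_sub hcK hle u
  have hQpd := posDef_of_sub hcK hQK
  have hKH' : ((1 + b) • K - H').PosSemidef := by
    rw [posSemidef_sub_iff hcK.isHermitian hH'.isHermitian]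
    intro v
    simpa [Matrix.smul_mulVec] using h3 v
  refine ⟨by simpa using hQK.add hKH', ?_⟩
  rw [sigma_eq hH', sigma_eq hH, sub_add_cancel, sub_add_cancel]
  have t1 : (K⁻¹ * Q).trace ≤ (1 + b) ^ 2 * (K⁻¹ * B).trace := by
    have := trace_inv_mul_bfgs_le_self hcK hle u
    have hdet : IsUnit K.det := (Matrix.isUnit_iff_isUnit_det K).mp hK.isUnit
    have hinv : ((1 + b) • K)⁻¹ = (1 + b)⁻¹ • K⁻¹ := by
      have := Matrix.inv_smul' K (Units.mk0 (1 + b) hc.ne') hdet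
      simpa [Units.smul_def] using this
    rw [← hQ, hinv] at this
    simp only [Matrix.smul_mul, Matrix.mul_smul, Matrix.trace_smul, smul_eq_mul] at this
    exact le_of_mul_le_mul_left (this.trans_eq (mul_left_comm _ _ _)) (inv_pos.mpr hc)
  have t2 := trace_mul_le_of_sub (posSemidef_smul_inv_sub_inv hK hH' h4) hQpd.posSemidef
  have t3 := trace_mul_le_of_sub (posSemidef_smul_inv_sub_inv hH hK h2) hB.posSemidef
  rw [Matrix.smul_mul, Matrix.trace_smul, smul_eq_mul] at t2 t3
  -- The fourth power: one factor from H'⁻¹ to K⁻¹, two from the scaling of B relative to K, one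
  -- from K⁻¹ back to H⁻¹.
  calc (H'⁻¹ * Q).trace ≤ (1 + b) * (K⁻¹ * Q).trace := t2
    _ ≤ (1 + b) * ((1 + b) ^ 2 * ((1 + b) * (H⁻¹ * B).trace)) := by
        gcongr
        exact t1.trans (by gcongr)
    _ = _ := by ring

end Update

/-! ### Hessian bounds, averaged Hessians and self-concordance. -/

section Hessian

variable {d : ℕ}

theorem norm_toLp_sq (v : Fin d → ℝ) : ‖(WithLp.toLp 2 v : Vec d)‖ ^ 2 = v ⬝ᵥ v := by
  rw [EuclideanSpace.norm_sq_eq]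
  simp [dotProduct, sq]

theorem inner_toLp (v w : Fin d → ℝ) :
    inner ℝ (WithLp.toLp 2 v : Vec d) (WithLp.toLp 2 w) = v ⬝ᵥ w := by
  simp [PiLp.inner_apply, dotProduct, mul_comm]

theorem toLp_eq_sum (v : Fin d → ℝ) :
    (WithLp.toLp 2 v : Vec d) = ∑ i, v i • (EuclideanSpace.single i 1 : Vec d) := by
  ext j
  simp [Pi.single_apply]

theorem dotProduct_hess_mulVec (f : Vec d → ℝ) (x : Vec d) (w v : Fin d → ℝ) :
    w ⬝ᵥ (hess f x *ᵥ v) =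
      fderiv ℝ (fun y => fderiv ℝ f y) x (WithLp.toLp 2 w) (WithLp.toLp 2 v) := by
  rw [toLp_eq_sum w, toLp_eq_sum v]
  simp only [map_sum, map_smul, sum_apply, smul_apply,
    smul_eq_mul, dotProduct, Matrix.mulVec, hess, Matrix.of_apply]
  simp only [Finset.mul_sum]
  rw [Finset.sum_comm]
  refine Finset.sum_congr rfl fun i _ => ?_
  refine Finset.sum_congr rfl fun j _ => by ring

variable {f : Vec d → ℝ}

theorem contDiff_fderiv (hf : ContDiff ℝ 2 f) : ContDiff ℝ 1 fun y => fderiv ℝ f y :=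
  hf.fderiv_right (m := 1) (by norm_num)

theorem continuous_hess (hf : ContDiff ℝ 2 f) (i j : Fin d) :
    Continuous fun x => hess f x i j := by
  have h := (contDiff_fderiv hf).continuous_fderiv one_ne_zero
  exact (h.clm_apply continuous_const).clm_apply continuous_const

theorem isHermitian_hess (hf : ContDiff ℝ 2 f) (x : Vec d) : (hess f x).IsHermitian := by
  ext i j
  have h := (hf.contDiffAt (x := x)).isSymmSndFDerivAt (by simp)
  exact h _ _

theorem fderiv_apply_eq_inner_gradient (x v : Vec d) :
    fderiv ℝ f x v = inner ℝ (gradient f x) v := by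
  rw [← InnerProductSpace.toDual_apply_apply (𝕜 := ℝ), toDual_gradient]

theorem hasDerivAt_fderiv_line (hf : ContDiff ℝ 2 f) (x s v : Vec d) (t : ℝ) :
    HasDerivAt (fun τ : ℝ => fderiv ℝ f (x + τ • s) v)
      (fderiv ℝ (fun y => fderiv ℝ f y) (x + t • s) s v) t := by
  have h1 : HasDerivAt (fun τ : ℝ => x + τ • s) s t := by
    simpa using ((hasDerivAt_id t).smul_const s).const_add x
  have h2 := ((contDiff_fderiv hf).differentiable one_ne_zero (x + t • s)).hasFDerivAt
  have h3 : HasDerivAt (fun τ : ℝ => fderiv ℝ f (x + τ • s))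
      (fderiv ℝ (fun y => fderiv ℝ f y) (x + t • s) s) t := h2.comp_hasDerivAt t h1
  exact (ContinuousLinearMap.apply ℝ ℝ v).hasFDerivAt.comp_hasDerivAt t h3

theorem StronglyConvex.le_inner {μ : ℝ} (h : StronglyConvex μ f) (x y : Vec d) :
    μ * ‖y - x‖ ^ 2 ≤ inner ℝ (gradient f y) (y - x) - inner ℝ (gradient f x) (y - x) := by
  have h1 := h x y
  have h2 := h y x
  rw [norm_sub_rev, ← neg_sub y x, inner_neg_right] at h2
  linarith

theorem Smooth.inner_le {L : ℝ} (h : Smooth L f) (x y : Vec d) :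
    inner ℝ (gradient f y) (y - x) - inner ℝ (gradient f x) (y - x) ≤ L * ‖y - x‖ ^ 2 := by
  have h1 := h x y
  have h2 := h y x
  rw [norm_sub_rev, ← neg_sub y x, inner_neg_right] at h2
  linarith

/-- Strong convexity makes τ ↦ ⟨∇f(x+τw), w⟩ - μ‖w‖²τ monotone, so its derivative at 0 is
nonnegative. -/
theorem le_dotProduct_hess {μ : ℝ} (hf : ContDiff ℝ 2 f) (h : StronglyConvex μ f) (x : Vec d)
    (v : Fin d → ℝ) : μ * (v ⬝ᵥ v) ≤ v ⬝ᵥ (hess f x *ᵥ v) := by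
  rw [dotProduct_hess_mulVec, ← norm_toLp_sq]
  set w : Vec d := WithLp.toLp 2 v
  have hd := (hasDerivAt_fderiv_line hf x w w 0).sub
    ((hasDerivAt_id (0 : ℝ)).const_mul (μ * ‖w‖ ^ 2))
  have hm : Monotone ((fun τ : ℝ => fderiv ℝ f (x + τ • w) w) -
      fun τ : ℝ => μ * ‖w‖ ^ 2 * id τ) := by
    intro a b hab
    rcases hab.eq_or_lt with rfl | hab
    · exact le_rfl
    have h1 := h.le_inner (x + a • w) (x + b • w)
    have e : x + b • w - (x + a • w) = (b - a) • w := by module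
    simp only [e, norm_smul, ← fderiv_apply_eq_inner_gradient,
      Real.norm_eq_abs, mul_pow, sq_abs, map_smul, smul_eq_mul] at h1
    simp only [Pi.sub_apply, id]
    have h2 : (b - a) * (μ * ‖w‖ ^ 2 * (b - a)) ≤
        (b - a) * (fderiv ℝ f (x + b • w) w - fderiv ℝ f (x + a • w) w) := by linarith
    have := le_of_mul_le_mul_left h2 (sub_pos.mpr hab)
    linarith
  have := hm.deriv_nonneg (x := 0)
  rw [hd.deriv] at this
  simp only [zero_smul, add_zero] at this
  linarith

theorem dotProduct_hess_le {L : ℝ} (hf : ContDiff ℝ 2 f) (h : Smooth L f) (x : Vec d)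
    (v : Fin d → ℝ) : v ⬝ᵥ (hess f x *ᵥ v) ≤ L * (v ⬝ᵥ v) := by
  rw [dotProduct_hess_mulVec, ← norm_toLp_sq]
  set w : Vec d := WithLp.toLp 2 v
  have hd := ((hasDerivAt_id (0 : ℝ)).const_mul (L * ‖w‖ ^ 2)).sub
    (hasDerivAt_fderiv_line hf x w w 0)
  have hm : Monotone ((fun τ : ℝ => L * ‖w‖ ^ 2 * id τ) -
      fun τ : ℝ => fderiv ℝ f (x + τ • w) w) := by
    intro a b hab
    rcases hab.eq_or_lt with rfl | hab
    · exact le_rfl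
    have h1 := h.inner_le (x + a • w) (x + b • w)
    have e : x + b • w - (x + a • w) = (b - a) • w := by module
    simp only [e, norm_smul, ← fderiv_apply_eq_inner_gradient,
      Real.norm_eq_abs, mul_pow, sq_abs, map_smul, smul_eq_mul] at h1
    simp only [Pi.sub_apply, id]
    have h2 : (b - a) * (fderiv ℝ f (x + b • w) w - fderiv ℝ f (x + a • w) w) ≤
        (b - a) * (L * ‖w‖ ^ 2 * (b - a)) := by linarith
    have := le_of_mul_le_mul_left h2 (sub_pos.mpr hab)
    linarith
  have := hm.deriv_nonneg (x := 0)
  rw [hd.deriv] at this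
  simp only [zero_smul, add_zero] at this
  linarith

theorem abs_dotProduct_mulVec_le (A : Mat d) (w v : Fin d → ℝ) :
    |w ⬝ᵥ (A *ᵥ v)| ≤ specNorm A * (‖(WithLp.toLp 2 w : Vec d)‖ * ‖(WithLp.toLp 2 v : Vec d)‖) := by
  rw [← inner_toLp, ← Matrix.toEuclideanCLM_toLp]
  refine (abs_real_inner_le_norm _ _).trans ?_
  have := (Matrix.toEuclideanCLM (n := Fin d) (𝕜 := ℝ) A).le_opNorm (WithLp.toLp 2 v)
  unfold specNorm
  nlinarith [norm_nonneg (WithLp.toLp 2 w : Vec d)]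

theorem abs_dotProduct_hess_sub_le {Lt : ℝ} (h : HessLipschitz Lt f) (x y : Vec d)
    (w v : Fin d → ℝ) :
    |w ⬝ᵥ ((hess f y - hess f x) *ᵥ v)| ≤
      Lt * ‖y - x‖ * (‖(WithLp.toLp 2 w : Vec d)‖ * ‖(WithLp.toLp 2 v : Vec d)‖) :=
  (abs_dotProduct_mulVec_le _ _ _).trans (mul_le_mul_of_nonneg_right (h x y) (by positivity))

theorem continuous_dotProduct_hess_line (hf : ContDiff ℝ 2 f) (x s : Vec d) (w v : Fin d → ℝ) :
    Continuous fun τ : ℝ => w ⬝ᵥ (hess f (x + τ • s) *ᵥ v) := by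
  simp only [dotProduct, Matrix.mulVec]
  have h : ∀ i j, Continuous fun τ : ℝ => hess f (x + τ • s) i j := fun i j =>
    (continuous_hess hf i j).comp (by fun_prop)
  fun_prop

theorem dotProduct_avgHess_mulVec (hf : ContDiff ℝ 2 f) (x y : Vec d) (w v : Fin d → ℝ) :
    w ⬝ᵥ (avgHess f x y *ᵥ v) =
      ∫ τ in (0 : ℝ)..1, w ⬝ᵥ (hess f (x + τ • (y - x)) *ᵥ v) := by
  have h : ∀ i j, Continuous fun τ : ℝ => hess f (x + τ • (y - x)) i j := fun i j =>
    (continuous_hess hf i j).comp (by fun_prop)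
  simp only [dotProduct, Matrix.mulVec, avgHess, Matrix.of_apply]
  rw [intervalIntegral.integral_finsetSum]
  · refine Finset.sum_congr rfl fun i _ => ?_
    rw [intervalIntegral.integral_const_mul, intervalIntegral.integral_finsetSum]
    · simp only [intervalIntegral.integral_mul_const]
    · intro j _
      exact ((h i j).mul continuous_const).intervalIntegrable _ _
  · intro i _
    refine Continuous.intervalIntegrable ?_ _ _
    fun_prop

theorem isHermitian_avgHess (hf : ContDiff ℝ 2 f) (x y : Vec d) :
    (avgHess f x y).IsHermitian := by
  ext i j
  simp only [Matrix.conjTranspose_apply, avgHess, Matrix.of_apply, star_trivial]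
  congr 1
  ext τ
  simpa using (isHermitian_hess hf (x + τ • (y - x))).apply i j

/-- The fundamental theorem of calculus for the gradient along a segment. -/
theorem avgHess_mulVec_sub (hf : ContDiff ℝ 2 f) (x y : Vec d) :
    avgHess f x y *ᵥ (y - x).ofLp = (gradient f y - gradient f x).ofLp := by
  ext j
  have e : ∀ g : Fin d → ℝ, g j = (Pi.single j 1 : Fin d → ℝ) ⬝ᵥ g := by simp
  -- After testing against eⱼ, symmetry puts y - x in the first slot, where the integrand is the
  -- derivative along the segment of the j-th partial derivative.
  rw [e (_ *ᵥ _), dotProduct_mulVec_comm (isHermitian_avgHess hf x y), dotProduct_avgHess_mulVec hf]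
  simp only [dotProduct_hess_mulVec]
  rw [intervalIntegral.integral_eq_sub_of_hasDerivAt
    (f := fun τ : ℝ => fderiv ℝ f (x + τ • (y - x)) (WithLp.toLp 2 (Pi.single j 1)))]
  · have hg : ∀ z : Vec d, fderiv ℝ f z (WithLp.toLp 2 (Pi.single j 1)) = gradient f z j := by
      intro z
      rw [fderiv_apply_eq_inner_gradient]
      exact (inner_toLp (gradient f z).ofLp _).trans (by simp)
    rw [one_smul, zero_smul, add_zero, add_sub_cancel, hg, hg]
    rfl
  · intro τ _
    exact hasDerivAt_fderiv_line hf x (y - x) _ τ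
  · refine Continuous.intervalIntegrable ?_ _ _
    have := continuous_dotProduct_hess_line hf x (y - x) (y - x).ofLp (Pi.single j 1)
    simpa only [dotProduct_hess_mulVec] using this

theorem abs_dotProduct_avgHess_sub_left_le {Lt : ℝ} (hf : ContDiff ℝ 2 f)
    (h : HessLipschitz Lt f) (x y : Vec d) (w v : Fin d → ℝ) :
    |w ⬝ᵥ (avgHess f x y *ᵥ v) - w ⬝ᵥ (hess f x *ᵥ v)| ≤
      Lt / 2 * ‖y - x‖ * (‖(WithLp.toLp 2 w : Vec d)‖ * ‖(WithLp.toLp 2 v : Vec d)‖) := by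
  set c := Lt * ‖y - x‖ * (‖(WithLp.toLp 2 w : Vec d)‖ * ‖(WithLp.toLp 2 v : Vec d)‖) with hc
  have hcont := continuous_dotProduct_hess_line hf x (y - x) w v
  have e : w ⬝ᵥ (avgHess f x y *ᵥ v) - w ⬝ᵥ (hess f x *ᵥ v) =
      ∫ τ in (0 : ℝ)..1, (w ⬝ᵥ (hess f (x + τ • (y - x)) *ᵥ v) - w ⬝ᵥ (hess f x *ᵥ v)) := by
    rw [intervalIntegral.integral_sub (hcont.intervalIntegrable _ _) (by simp),
      dotProduct_avgHess_mulVec hf]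
    simp
  rw [e, ← Real.norm_eq_abs]
  have hb := intervalIntegral.norm_integral_le_of_norm_le (μ := MeasureTheory.volume)
    (f := fun τ : ℝ => w ⬝ᵥ (hess f (x + τ • (y - x)) *ᵥ v) - w ⬝ᵥ (hess f x *ᵥ v))
    (g := fun τ => τ * c) (a := 0) (b := 1) zero_le_one
    (Filter.Eventually.of_forall fun τ hτ => by
      have := abs_dotProduct_hess_sub_le h x (x + τ • (y - x)) w v
      rw [Matrix.sub_mulVec, dotProduct_sub, add_sub_cancel_left, norm_smul, Real.norm_eq_abs,
        abs_of_pos hτ.1] at this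
      rw [Real.norm_eq_abs]
      exact this.trans_eq (by rw [hc]; ring))
    ((continuous_id.mul continuous_const).intervalIntegrable _ _)
  refine hb.trans_eq ?_
  rw [intervalIntegral.integral_mul_const, integral_id, hc]
  ring

theorem abs_dotProduct_avgHess_sub_right_le {Lt : ℝ} (hf : ContDiff ℝ 2 f)
    (h : HessLipschitz Lt f) (x y : Vec d) (w v : Fin d → ℝ) :
    |w ⬝ᵥ (avgHess f x y *ᵥ v) - w ⬝ᵥ (hess f y *ᵥ v)| ≤
      Lt / 2 * ‖y - x‖ * (‖(WithLp.toLp 2 w : Vec d)‖ * ‖(WithLp.toLp 2 v : Vec d)‖) := by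
  have e : avgHess f x y = avgHess f y x := by
    ext i j
    simp only [avgHess, Matrix.of_apply]
    have := intervalIntegral.integral_comp_sub_left (a := 0) (b := 1)
      (fun τ : ℝ => hess f (y + τ • (x - y)) i j) 1
    rw [sub_self, sub_zero] at this
    rw [← this]
    congr 1
    ext τ
    rw [show x + τ • (y - x) = y + (1 - τ) • (x - y) by module]
  rw [e, norm_sub_rev]
  exact abs_dotProduct_avgHess_sub_left_le hf h y x w v

theorem sqrt_mul_norm_le_localNorm {μ : ℝ} (hμ : 0 < μ) (hf : ContDiff ℝ 2 f)
    (h : StronglyConvex μ f) (x y : Vec d) : √μ * ‖y‖ ≤ localNorm f x y := by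
  refine Real.le_sqrt_of_sq_le ?_
  rw [mul_pow, Real.sq_sqrt hμ.le]
  have := le_dotProduct_hess hf h x y.ofLp
  rwa [← norm_toLp_sq] at this

theorem localNorm_le {L : ℝ} (hL : 0 ≤ L) (hf : ContDiff ℝ 2 f)
    (h : Smooth L f) (x y : Vec d) : localNorm f x y ≤ √L * ‖y‖ := by
  refine Real.sqrt_le_left (by positivity) |>.mpr ?_
  rw [mul_pow, Real.sq_sqrt hL]
  have := dotProduct_hess_le hf h x y.ofLp
  rwa [← norm_toLp_sq] at this

theorem concM_nonneg {μ Lt : ℝ} (hμ : 0 < μ) (hLt : 0 ≤ Lt) : 0 ≤ concM μ Lt :=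
  div_nonneg hLt (Real.rpow_nonneg hμ.le _)

theorem beta_nonneg {M : ℝ} (hM : 0 ≤ M) (x y : Vec d) : 0 ≤ beta M f x y :=
  mul_nonneg (by positivity) (Real.sqrt_nonneg _)

/-- The power 3/2 in M is explained here: √μ‖s‖ ≤ ‖s‖_x absorbs one half power, and the remaining μ
lets an additive error be charged to a form bounded below by μ‖v‖². -/
theorem lipschitz_mul_norm_le_beta {μ Lt : ℝ} (hμ : 0 < μ) (hLt : 0 ≤ Lt)
    (hf : ContDiff ℝ 2 f) (h : StronglyConvex μ f) (x y : Vec d) :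
    Lt / 2 * ‖y - x‖ ≤ beta (concM μ Lt) f x y * μ := by
  have h1 := sqrt_mul_norm_le_localNorm hμ hf h x (y - x)
  have e : μ ^ ((3 : ℝ) / 2) = μ * √μ := by
    rw [show (3 : ℝ) / 2 = 1 + 1 / 2 by norm_num, Real.rpow_add hμ, Real.rpow_one,
      Real.sqrt_eq_rpow]
  have hs : 0 < √μ := Real.sqrt_pos.mpr hμ
  unfold beta concM
  rw [e]
  calc Lt / 2 * ‖y - x‖ = Lt / (μ * √μ) / 2 * (√μ * ‖y - x‖) * μ := by field_simp
    _ ≤ _ := by gcongr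

/-- Both end-point Hessians are within the factor `1 + β` of the averaged Hessian. -/
theorem avgHess_comparison {μ Lt : ℝ} (hμ : 0 < μ) (hLt : 0 ≤ Lt)
    (hf : ContDiff ℝ 2 f) (h : StronglyConvex μ f) (hLip : HessLipschitz Lt f) (x y : Vec d) :
    (∀ v, μ * (v ⬝ᵥ v) ≤ v ⬝ᵥ (avgHess f x y *ᵥ v)) ∧
    (∀ v, v ⬝ᵥ (avgHess f x y *ᵥ v) ≤
      (1 + beta (concM μ Lt) f x y) * (v ⬝ᵥ (hess f x *ᵥ v))) ∧
    (∀ v, v ⬝ᵥ (hess f x *ᵥ v) ≤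
      (1 + beta (concM μ Lt) f x y) * (v ⬝ᵥ (avgHess f x y *ᵥ v))) ∧
    (∀ v, v ⬝ᵥ (hess f y *ᵥ v) ≤
      (1 + beta (concM μ Lt) f x y) * (v ⬝ᵥ (avgHess f x y *ᵥ v))) ∧
    (∀ v, v ⬝ᵥ (avgHess f x y *ᵥ v) ≤
      (1 + beta (concM μ Lt) f x y) * (v ⬝ᵥ (hess f y *ᵥ v))) := by
  have h0 : ∀ v, μ * (v ⬝ᵥ v) ≤ v ⬝ᵥ (avgHess f x y *ᵥ v) := by
    intro v
    rw [dotProduct_avgHess_mulVec hf]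
    calc μ * (v ⬝ᵥ v) = ∫ _τ in (0 : ℝ)..1, μ * (v ⬝ᵥ v) := by simp
      _ ≤ _ := intervalIntegral.integral_mono_on zero_le_one (by simp)
        ((continuous_dotProduct_hess_line hf x (y - x) v v).intervalIntegrable _ _)
        fun τ _ => le_dotProduct_hess hf h _ v
  have hβ := beta_nonneg (f := f) (concM_nonneg hμ hLt) x y
  have hb := lipschitz_mul_norm_le_beta hμ hLt hf h x y
  -- Additive to multiplicative: an error of at most βμ‖v‖² is at most βb, because b ≥ μ‖v‖².
  have key : ∀ {a b : ℝ} {v : Fin d → ℝ}, μ * (v ⬝ᵥ v) ≤ b →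
      a - b ≤ Lt / 2 * ‖y - x‖ * (‖(WithLp.toLp 2 v : Vec d)‖ * ‖(WithLp.toLp 2 v : Vec d)‖) →
      a ≤ (1 + beta (concM μ Lt) f x y) * b := by
    intro a b v h1 h2
    rw [← sq, norm_toLp_sq] at h2
    have h3 : 0 ≤ v ⬝ᵥ v := by rw [← norm_toLp_sq]; positivity
    have h4 := mul_le_mul_of_nonneg_right hb h3
    have h5 := mul_le_mul_of_nonneg_left h1 hβ
    linarith
  have hl := fun v => abs_le.mp (abs_dotProduct_avgHess_sub_left_le hf hLip x y v v)
  have hr := fun v => abs_le.mp (abs_dotProduct_avgHess_sub_right_le hf hLip x y v v)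
  exact ⟨h0, fun v => key (le_dotProduct_hess hf h x v) (hl v).2,
    fun v => key (h0 v) (by linarith [(hl v).1]), fun v => key (h0 v) (by linarith [(hr v).1]),
    fun v => key (le_dotProduct_hess hf h y v) (hr v).2⟩

end Hessian

/-! ### One iteration: the new iterate and the updated matrix. -/

section Step

variable {d : ℕ}

theorem norm_toLp_mulVec_le_trace {C : Mat d} (hC : C.PosSemidef) (v : Fin d → ℝ) :
    ‖(WithLp.toLp 2 (C *ᵥ v) : Vec d)‖ ≤ C.trace * ‖(WithLp.toLp 2 v : Vec d)‖ := by
  refine abs_le_of_sq_le_sq' ?_ (mul_nonneg hC.trace_nonneg (norm_nonneg _)) |>.2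
  rw [mul_pow, norm_toLp_sq, norm_toLp_sq]
  exact mulVec_dotProduct_self_le hC v

theorem norm_toLp_mulVec_le {A : Mat d} {c : ℝ} {v : Fin d → ℝ}
    (h : ∀ w, |w ⬝ᵥ (A *ᵥ v)| ≤
      c * (‖(WithLp.toLp 2 w : Vec d)‖ * ‖(WithLp.toLp 2 v : Vec d)‖)) :
    ‖(WithLp.toLp 2 (A *ᵥ v) : Vec d)‖ ≤ c * ‖(WithLp.toLp 2 v : Vec d)‖ := by
  have h1 := (le_abs_self _).trans (h (A *ᵥ v))
  rw [← norm_toLp_sq] at h1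
  rcases (norm_nonneg (WithLp.toLp 2 (A *ᵥ v) : Vec d)).eq_or_lt with h0 | h0
  -- When Av = 0 the sign of c is not given; testing with w = v excludes a negative right-hand side.
  · have h2 := (abs_nonneg _).trans (h v)
    rw [← h0]
    by_contra! hneg
    have h3 : 0 < ‖(WithLp.toLp 2 v : Vec d)‖ := by
      rcases (norm_nonneg (WithLp.toLp 2 v : Vec d)).eq_or_lt with h4 | h4
      · rw [← h4] at hneg
        simp at hneg
      · exact h4
    nlinarith
  · nlinarith

/-- The residual of the quasi-Newton model of one component at the minimizer. -/
theorem norm_residual_le {f : Vec d → ℝ} {μ L Lt : ℝ} (hμ : 0 < μ) (hf : ContDiff ℝ 2 f)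
    (hsc : StronglyConvex μ f) (hsm : Smooth L f) (hLip : HessLipschitz Lt f)
    {B : Mat d} {z xs : Vec d} (hB : (B - hess f z).PosSemidef) :
    ‖(WithLp.toLp 2 (B *ᵥ (z - xs).ofLp - (gradient f z - gradient f xs).ofLp) : Vec d)‖ ≤
      (L * sigma B (hess f z) + Lt / 2 * ‖z - xs‖) * ‖z - xs‖ := by
  have hH := posDef_of_le (isHermitian_hess hf z) hμ (le_dotProduct_hess hf hsc z)
  -- The gradient difference is the averaged Hessian applied to z - x⋆, so the residual splits into
  -- a Hessian-Lipschitz part and the part due to B - ∇²f(z).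
  have e : B *ᵥ (z - xs).ofLp - (gradient f z - gradient f xs).ofLp =
      (avgHess f z xs - hess f z) *ᵥ (xs - z).ofLp - (B - hess f z) *ᵥ (xs - z).ofLp := by
    have h := avgHess_mulVec_sub hf z xs
    have h2 : (z - xs).ofLp = -(xs - z).ofLp := by simp
    have h3 : (gradient f z - gradient f xs).ofLp = -(gradient f xs - gradient f z).ofLp := by simp
    rw [Matrix.sub_mulVec, Matrix.sub_mulVec, h, h2, h3, Matrix.mulVec_neg]
    abel
  have h1 : ‖(WithLp.toLp 2 ((avgHess f z xs - hess f z) *ᵥ (xs - z).ofLp) : Vec d)‖ ≤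
      Lt / 2 * ‖xs - z‖ * ‖xs - z‖ :=
    norm_toLp_mulVec_le fun w => by
      rw [Matrix.sub_mulVec, dotProduct_sub]
      exact abs_dotProduct_avgHess_sub_left_le hf hLip z xs w _
  have h2 : ‖(WithLp.toLp 2 ((B - hess f z) *ᵥ (xs - z).ofLp) : Vec d)‖ ≤
      (B - hess f z).trace * ‖xs - z‖ := norm_toLp_mulVec_le_trace hB _
  have h3 := mul_le_mul_of_nonneg_right
    (trace_sub_le_sigma hH (dotProduct_hess_le hf hsm z) hB) (norm_nonneg (xs - z))
  rw [e, WithLp.toLp_sub, norm_sub_rev z xs]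
  refine (norm_sub_le _ _).trans ?_
  linarith

theorem le_dotProduct_of_sub {B H : Mat d} {μ : ℝ} (hB : (B - H).PosSemidef)
    (h : ∀ v, μ * (v ⬝ᵥ v) ≤ v ⬝ᵥ (H *ᵥ v)) (v : Fin d → ℝ) :
    μ * (v ⬝ᵥ v) ≤ v ⬝ᵥ (B *ᵥ v) := by
  have := hB.dotProduct_nonneg v
  rw [Matrix.sub_mulVec, dotProduct_sub] at this
  linarith [h v]

theorem isHermitian_of_sub {B H : Mat d} (hB : (B - H).PosSemidef) (hH : H.IsHermitian) :
    B.IsHermitian := by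
  simpa using hB.isHermitian.add hH

theorem norm_newIterate_sub_le {n : ℕ} [NeZero n] {f : Fin n → Vec d → ℝ} {z : Fin n → Vec d}
    {B : Fin n → Mat d} {xs : Vec d} {μ c : ℝ} (hμ : 0 < μ)
    (hB : ∀ i, (B i).IsHermitian) (hBμ : ∀ i v, μ * (v ⬝ᵥ v) ≤ v ⬝ᵥ (B i *ᵥ v))
    (hxs : ∑ i, gradient (f i) xs = 0)
    (hc : ∀ i, ‖(WithLp.toLp 2 (B i *ᵥ (z i - xs).ofLp -
      (gradient (f i) (z i) - gradient (f i) xs).ofLp) : Vec d)‖ ≤ c) :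
    ‖newIterate f z B - xs‖ ≤ c / μ := by
  have hn : (0 : ℝ) < n := by exact_mod_cast Nat.pos_of_neZero n
  set S := ∑ i, B i with hS
  have hSh : S.IsHermitian := by
    rw [hS, Matrix.IsHermitian, Matrix.conjTranspose_sum]
    exact Finset.sum_congr rfl fun i _ => hB i
  have hSμ : ∀ v, (n * μ) * (v ⬝ᵥ v) ≤ v ⬝ᵥ (S *ᵥ v) := by
    intro v
    rw [hS, Matrix.sum_mulVec, dotProduct_sum]
    calc (n * μ) * (v ⬝ᵥ v) = ∑ _i : Fin n, μ * (v ⬝ᵥ v) := by simp [mul_assoc]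
      _ ≤ _ := Finset.sum_le_sum fun i _ => hBμ i v
  have hSpd := posDef_of_le hSh (by positivity) hSμ
  set r : Vec d := ∑ i, WithLp.toLp 2 (B i *ᵥ (z i - xs).ofLp -
      (gradient (f i) (z i) - gradient (f i) xs).ofLp) with hr
  set w : Vec d := newIterate f z B - xs with hw
  have hSw : S *ᵥ w.ofLp = r.ofLp := by
    have h1 : S *ᵥ (newIterate f z B).ofLp =
        ∑ i, (B i *ᵥ (z i).ofLp - (gradient (f i) (z i)).ofLp) := mulVec_inv_mulVec hSpd _
    have h2 : ∑ i, (gradient (f i) xs).ofLp = 0 := by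
      rw [← WithLp.ofLp_sum, hxs]; rfl
    rw [hw, WithLp.ofLp_sub, Matrix.mulVec_sub, h1, hr, WithLp.ofLp_sum, hS, Matrix.sum_mulVec]
    simp only [WithLp.ofLp_sub, Matrix.mulVec_sub, Finset.sum_sub_distrib, h2]
    abel
  have hrn : ‖r‖ ≤ n * c := by
    refine (norm_sum_le_of_le _ fun i _ => hc i).trans_eq ?_
    simp
  have h3 := hSμ w.ofLp
  rw [hSw, ← norm_toLp_sq, ← inner_toLp] at h3
  have h4 : n * μ * ‖w‖ ^ 2 ≤ ‖w‖ * ‖r‖ := h3.trans (real_inner_le_norm w r)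
  rw [le_div_iff₀ hμ]
  rcases (norm_nonneg w).eq_or_lt with h0 | h0
  · rw [← h0, zero_mul]
    exact (norm_nonneg _).trans (hc 0)
  · have h5 : n * (‖w‖ * (‖w‖ * μ)) ≤ n * (‖w‖ * c) := by nlinarith
    exact le_of_mul_le_mul_left (le_of_mul_le_mul_left h5 hn) h0

theorem sum_gradient_eq_zero {n : ℕ} [NeZero n] {f : Fin n → Vec d → ℝ} {xs : Vec d}
    (hf : ∀ i, ContDiff ℝ 2 (f i))
    (hmin : IsMinOn (fun y => (1 / (n : ℝ)) * ∑ i, f i y) Set.univ xs) :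
    ∑ i, gradient (f i) xs = 0 := by
  have hn : (n : ℝ) ≠ 0 := by exact_mod_cast NeZero.ne n
  have h0 := (hmin.isLocalMin Filter.univ_mem).fderiv_eq_zero
  have hd : ∀ i, DifferentiableAt ℝ (f i) xs := fun i => (hf i).differentiable two_ne_zero xs
  have h1 : HasFDerivAt (fun y => (1 / (n : ℝ)) * ∑ i, f i y)
      ((1 / (n : ℝ)) • ∑ i, fderiv ℝ (f i) xs) xs :=
    (HasFDerivAt.fun_sum fun i _ => (hd i).hasFDerivAt).const_mul _
  rw [h1.fderiv, smul_eq_zero_iff_right (by positivity)] at h0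
  simp only [gradient, ← map_sum, h0, map_zero]

/-- One update of a Hessian approximation: it stays above the Hessian, and its error contracts. -/
theorem update_step {f : Vec d → ℝ} {μ L Lt : ℝ} (hμ : 0 < μ) (hL : 0 < L) (hLt : 0 ≤ Lt)
    (hd : 0 < d) (hf : ContDiff ℝ 2 f) (hsc : StronglyConvex μ f) (hsm : Smooth L f)
    (hLip : HessLipschitz Lt f) {B Q : Mat d} {z z' : Vec d} {u : Fin d → ℝ}
    (hB : (B - hess f z).PosSemidef) (hQ : Q = classicUpdate (concM μ Lt) f B z z')
    (hu : IsGreedy Q (hess f z') u) :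
    (bfgs Q (hess f z') u - hess f z').PosSemidef ∧
      (0 ≤ 1 - μ / (d * L) → sigma (bfgs Q (hess f z') u) (hess f z') ≤
        (1 - μ / (d * L)) *
          ((1 + beta (concM μ Lt) f z z') ^ 4 * (sigma B (hess f z) + d) - d)) := by
  obtain ⟨h0, h1, h2, h3, h4⟩ := avgHess_comparison hμ hLt hf hsc hLip z z'
  have hK := posDef_of_le (isHermitian_avgHess hf z z') hμ h0
  have hH := posDef_of_le (isHermitian_hess hf z) hμ (le_dotProduct_hess hf hsc z)
  have hH' := posDef_of_le (isHermitian_hess hf z') hμ (le_dotProduct_hess hf hsc z')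
  obtain ⟨hQH, hσ⟩ := sigma_bfgs_smul_le (beta_nonneg (concM_nonneg hμ hLt) z z') hH hH' hK hB
    h1 h2 h3 h4 (z' - z).ofLp
  rw [← classicUpdate, ← hQ] at hQH hσ
  refine ⟨posSemidef_bfgs_sub hH' hQH u, fun ha => ?_⟩
  refine (sigma_bfgs_greedy_le hμ hL hd (isHermitian_hess hf z') (le_dotProduct_hess hf hsc z')
    (dotProduct_hess_le hf hsm z') hQH hu).trans (mul_le_mul_of_nonneg_left ?_ ha)
  linarith

end Step

/-! ### Scalar recursion, update counts and choice of the radius. -/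

section Rates

/-- The bound on the approximation error of a component after `k` updates. -/
noncomputable def errBound (a ρ γ D σ₀ : ℝ) (k : ℕ) : ℝ :=
  a ^ k * (Real.exp (γ * ∑ j ∈ Finset.range k, ρ ^ j) *
    (σ₀ + D * γ * ∑ j ∈ Finset.range k, (ρ / a) ^ j))

theorem errBound_step {a ρ γ D σ₀ b s : ℝ} (ha : 0 < a) (hρ : 0 < ρ) (hγ : 0 ≤ γ) (hD : 0 ≤ D)
    (hb : 0 ≤ b) (hσ₀ : 0 ≤ σ₀) (k : ℕ) (hbk : 4 * b ≤ γ * ρ ^ k)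
    (hs : s ≤ errBound a ρ γ D σ₀ k) :
    a * ((1 + b) ^ 4 * (s + D) - D) ≤ errBound a ρ γ D σ₀ (k + 1) := by
  have hT : 0 ≤ ∑ j ∈ Finset.range k, (ρ / a) ^ j :=
    Finset.sum_nonneg fun j _ => by positivity
  have hS : 0 ≤ ∑ j ∈ Finset.range k, ρ ^ j := Finset.sum_nonneg fun j _ => by positivity
  set x := γ * ρ ^ k with hx
  have hx0 : 0 ≤ x := by positivity
  set X := errBound a ρ γ D σ₀ k with hX
  have hX0 : 0 ≤ X := by rw [hX, errBound]; positivity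
  have h1 : (1 + b) ^ 4 ≤ Real.exp x := by
    calc (1 + b) ^ 4 ≤ Real.exp b ^ 4 := by gcongr; linarith [Real.add_one_le_exp b]
      _ = Real.exp (4 * b) := by rw [← Real.exp_nat_mul]; norm_num
      _ ≤ Real.exp x := Real.exp_le_exp.mpr hbk
  -- This is 1 - x ≤ exp(-x) multiplied by exp x; it converts the surplus D(exp x - 1) into D x exp
  -- x.
  have h2 : Real.exp x - 1 ≤ x * Real.exp x := by
    have := mul_le_mul_of_nonneg_left (Real.add_one_le_exp (-x)) (Real.exp_nonneg x)
    rw [← Real.exp_add, add_neg_cancel, Real.exp_zero] at this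
    linarith
  have h3 : (1 + b) ^ 4 * (s + D) - D ≤ Real.exp x * (X + D * x) := by
    calc (1 + b) ^ 4 * (s + D) - D ≤ (1 + b) ^ 4 * (X + D) - D := by gcongr
      _ ≤ Real.exp x * (X + D) - D := by gcongr
      _ ≤ _ := by nlinarith
  have h4 : X + D * x ≤ a ^ k * (Real.exp (γ * ∑ j ∈ Finset.range k, ρ ^ j) *
      (σ₀ + D * γ * ∑ j ∈ Finset.range (k + 1), (ρ / a) ^ j)) := by
    -- The injected error Dγρᵏ, written relative to aᵏ, is the next term of the series in ρ/a.
    have h5 : D * x ≤ a ^ k * (Real.exp (γ * ∑ j ∈ Finset.range k, ρ ^ j) *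
        (D * γ * (ρ / a) ^ k)) := by
      have e : D * x = a ^ k * (1 * (D * γ * (ρ / a) ^ k)) := by
        rw [hx, div_pow]; field_simp
      rw [e]
      gcongr
      exact Real.one_le_exp (by positivity)
    rw [Finset.sum_range_succ, hX, errBound]
    linarith
  calc a * ((1 + b) ^ 4 * (s + D) - D) ≤ a * (Real.exp x * (X + D * x)) := by gcongr
    _ ≤ a * (Real.exp x * (a ^ k * (Real.exp (γ * ∑ j ∈ Finset.range k, ρ ^ j) *
      (σ₀ + D * γ * ∑ j ∈ Finset.range (k + 1), (ρ / a) ^ j)))) := by gcongr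
    _ = errBound a ρ γ D σ₀ (k + 1) := by
      rw [errBound, Finset.sum_range_succ (fun j => ρ ^ j), mul_add γ, Real.exp_add, ← hx]
      ring

theorem sum_range_pow_le {r : ℝ} (h0 : 0 ≤ r) (h1 : r < 1) (k : ℕ) :
    ∑ j ∈ Finset.range k, r ^ j ≤ 1 / (1 - r) := by
  rw [one_div, ← tsum_geometric_of_lt_one h0 h1]
  exact (summable_geometric_of_lt_one h0 h1).sum_le_tsum _ fun j _ => by positivity

theorem errBound_le {d : ℕ} {μ L Lt ρ ε σ₀ : ℝ} (hμ : 0 < μ) (hLt : 0 ≤ Lt) (hρ0 : 0 < ρ)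
    (hρ1 : ρ < 1) (hρ : ρ < 1 - μ / (d * L)) (hε : 0 ≤ ε) (hσ₀ : 0 ≤ σ₀) (k : ℕ) :
    errBound (1 - μ / (d * L)) ρ (4 * concM μ Lt * √L * ε) d σ₀ k ≤
      (1 - μ / (d * L)) ^ k * delta d μ L Lt ρ ε σ₀ := by
  have hM := concM_nonneg hμ hLt
  set a := 1 - μ / (d * L)
  have ha : 0 < a := hρ0.trans hρ
  have h1 := sum_range_pow_le hρ0.le hρ1 k
  have h2 := sum_range_pow_le (div_nonneg hρ0.le ha.le) ((div_lt_one ha).mpr hρ) k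
  have hT : 0 ≤ ∑ j ∈ Finset.range k, (ρ / a) ^ j :=
    Finset.sum_nonneg fun j _ => by positivity
  have e : delta d μ L Lt ρ ε σ₀ = Real.exp (4 * concM μ Lt * √L * ε * (1 / (1 - ρ))) *
      (σ₀ + d * (4 * concM μ Lt * √L * ε) * (1 / (1 - ρ / a))) := by
    rw [delta]
    congr 2 <;> ring
  rw [e, errBound]
  gcongr

/-- The number of updates of component `i` during the first `t` iterations. -/
def updateCount (n t i : ℕ) : ℕ := (t + (n - 1 - i)) / n

theorem updateCount_zero {n i : ℕ} (hi : i < n) : updateCount n 0 i = 0 :=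
  Nat.div_eq_of_lt (by omega)

/-- Each component has completed at least t/n updates, so the worst memorized distance has exponent
at least t/n. -/
theorem div_le_updateCount (n t i : ℕ) : t / n ≤ updateCount n t i :=
  Nat.div_le_div_right (by omega)

theorem updateCount_mod {n : ℕ} (hn : 0 < n) (t : ℕ) : updateCount n t (t % n) = t / n := by
  have h1 := Nat.mod_lt t hn
  have h2 := Nat.div_add_mod t n
  rw [updateCount, show t + (n - 1 - t % n) = (n - 1) + n * (t / n) by omega,
    Nat.add_mul_div_left _ _ hn, Nat.div_eq_of_lt (by omega), zero_add]

theorem updateCount_succ_mod {n : ℕ} (hn : 0 < n) (t : ℕ) :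
    updateCount n (t + 1) (t % n) = t / n + 1 := by
  have h1 := Nat.mod_lt t hn
  have h2 := Nat.div_add_mod t n
  rw [updateCount, show t + 1 + (n - 1 - t % n) = n + n * (t / n) by omega,
    Nat.add_mul_div_left _ _ hn, Nat.div_self hn, add_comm]

theorem updateCount_succ_of_ne {n t i : ℕ} (hi : i < n) (h : i ≠ t % n) :
    updateCount n (t + 1) i = updateCount n t i := by
  have hn : 0 < n := by omega
  have h1 := Nat.mod_lt t hn
  have h2 := Nat.div_add_mod t n
  unfold updateCount
  rcases h.lt_or_gt with h | h
  · rw [show t + 1 + (n - 1 - i) = (t % n - i) + n * (t / n + 1) by rw [mul_add]; omega,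
      show t + (n - 1 - i) = (t % n - i - 1) + n * (t / n + 1) by rw [mul_add]; omega,
      Nat.add_mul_div_left _ _ hn, Nat.add_mul_div_left _ _ hn,
      Nat.div_eq_of_lt (show t % n - i < n by omega),
      Nat.div_eq_of_lt (show t % n - i - 1 < n by omega)]
  · rw [show t + 1 + (n - 1 - i) = (n + t % n - i) + n * (t / n) by omega,
      show t + (n - 1 - i) = (n + t % n - i - 1) + n * (t / n) by omega,
      Nat.add_mul_div_left _ _ hn, Nat.add_mul_div_left _ _ hn,
      Nat.div_eq_of_lt (show n + t % n - i < n by omega),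
      Nat.div_eq_of_lt (show n + t % n - i - 1 < n by omega)]

theorem ceil_succ_div {n : ℕ} (hn : 0 < n) (t : ℕ) :
    ⌈((t + 1 : ℕ) : ℝ) / (n : ℝ)⌉₊ = t / n + 1 := by
  have hn' : (0 : ℝ) < n := by exact_mod_cast hn
  have h1 := Nat.mod_lt t hn
  have h2 := Nat.div_add_mod t n
  rw [Nat.ceil_eq_iff (Nat.succ_ne_zero _), lt_div_iff₀ hn', div_le_iff₀ hn']
  constructor
  · norm_cast
    rw [Nat.succ_sub_one, mul_comm]
    omega
  · norm_cast
    rw [Nat.succ_mul, mul_comm (t / n)]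
    omega

/-- With ε = σ₀ the left side is continuous in ε and vanishes at 0, while ρμ > 0. -/
theorem exists_radius {d : ℕ} {μ L Lt ρ : ℝ} (hμ : 0 < μ) (hρ0 : 0 < ρ) :
    ∃ ε : ℝ, 0 < ε ∧ L * delta d μ L Lt ρ ε ε + Lt / 2 * ε ≤ ρ * μ := by
  have hc : Continuous fun ε : ℝ => L * delta d μ L Lt ρ ε ε + Lt / 2 * ε := by
    unfold delta
    fun_prop
  have h0 : L * delta d μ L Lt ρ 0 0 + Lt / 2 * 0 < ρ * μ := by
    simpa [delta] using mul_pos hρ0 hμ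
  have h1 : ∀ᶠ ε in nhdsWithin (0 : ℝ) (Set.Ioi 0),
      L * delta d μ L Lt ρ ε ε + Lt / 2 * ε < ρ * μ :=
    nhdsWithin_le_nhds ((hc.tendsto 0).eventually_lt_const h0)
  obtain ⟨ε, h2, h3⟩ := (h1.and self_mem_nhdsWithin).exists
  exact ⟨ε, h3, h2.le⟩

end Rates

/-! ### The joint induction along a run. -/

section Convergence

variable {d : ℕ}

theorem StronglyConvex.le_of_smooth {μ L : ℝ} {f : Vec d → ℝ} (hd : 0 < d)
    (hsc : StronglyConvex μ f) (hsm : Smooth L f) : μ ≤ L := by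
  have h := (hsc 0 (EuclideanSpace.single ⟨0, hd⟩ 1)).trans (hsm 0 _)
  simp at h
  linarith

theorem HessLipschitz.nonneg {Lt : ℝ} {f : Vec d → ℝ} (hd : 0 < d) (h : HessLipschitz Lt f) :
    0 ≤ Lt := by
  have h1 := (norm_nonneg _).trans (h 0 (EuclideanSpace.single ⟨0, hd⟩ 1))
  simpa using h1

theorem idx_succ_val (n : ℕ) [NeZero n] (t : ℕ) : (idx n (t + 1)).val = t % n := by
  simp [idx, Fin.ofNat]

/-- The invariants of a SIQN run started close to the minimizer. -/
theorem IsRun.invariant {n : ℕ} [NeZero n] {μ L Lt ρ ε σ₀ : ℝ} {f : Fin n → Vec d → ℝ}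
    {xs : Vec d} {x : ℕ → Vec d} {z : ℕ → Fin n → Vec d} {B : ℕ → Fin n → Mat d}
    (hd : 0 < d) (hμ : 0 < μ) (hL : 0 < L) (hLt : 0 ≤ Lt) (hρ0 : 0 < ρ)
    (hρ : ρ < 1 - μ / (d * L)) (hσ₀ : 0 ≤ σ₀)
    (hε : L * delta d μ L Lt ρ ε σ₀ + Lt / 2 * ε ≤ ρ * μ)
    (hf : ∀ i, ContDiff ℝ 2 (f i)) (hsc : ∀ i, StronglyConvex μ (f i))
    (hsm : ∀ i, Smooth L (f i)) (hLip : ∀ i, HessLipschitz Lt (f i))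
    (hmin : IsMinOn (fun y => (1 / (n : ℝ)) * ∑ i, f i y) Set.univ xs)
    (hrun : IsRun (concM μ Lt) f x z B) (hx : ‖x 0 - xs‖ ≤ ε)
    (hσ : ∀ i, sigma (B 0 i) (hess (f i) (x 0)) ≤ σ₀) (t : ℕ) :
    (∀ i, ‖z t i - xs‖ ≤ ρ ^ updateCount n t i * ‖x 0 - xs‖ ∧
      (B t i - hess (f i) (z t i)).PosSemidef ∧
      sigma (B t i) (hess (f i) (z t i)) ≤
        errBound (1 - μ / (d * L)) ρ (4 * concM μ Lt * √L * ε) d σ₀ (updateCount n t i)) ∧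
    ‖x (t + 1) - xs‖ ≤ ρ ^ (t / n + 1) * ‖x 0 - xs‖ := by
  have hn := Nat.pos_of_neZero n
  have hd' : (0 : ℝ) < d := by exact_mod_cast hd
  have hM := concM_nonneg hμ hLt
  have hε0 : 0 ≤ ε := (norm_nonneg _).trans hx
  have hfrac : 0 < μ / (d * L) := by positivity
  have ha0 : 0 < 1 - μ / (d * L) := hρ0.trans hρ
  have ha1 : 1 - μ / (d * L) ≤ 1 := by linarith
  have hρ1 : ρ < 1 := by linarith
  have hr0 := norm_nonneg (x 0 - xs)
  have hgrad := sum_gradient_eq_zero hf hmin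
  -- the invariants of the memory imply the bound on the next iterate
  have next : ∀ t, (∀ i, ‖z t i - xs‖ ≤ ρ ^ updateCount n t i * ‖x 0 - xs‖ ∧
      (B t i - hess (f i) (z t i)).PosSemidef ∧
      sigma (B t i) (hess (f i) (z t i)) ≤
        errBound (1 - μ / (d * L)) ρ (4 * concM μ Lt * √L * ε) d σ₀ (updateCount n t i)) →
      ‖x (t + 1) - xs‖ ≤ ρ ^ (t / n + 1) * ‖x 0 - xs‖ := by
    intro t ht
    rw [hrun.step_x t]
    set R := ρ ^ (t / n) * ‖x 0 - xs‖ with hR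
    have hRε : R ≤ ε := (mul_le_of_le_one_left hr0 (pow_le_one₀ hρ0.le hρ1.le)).trans hx
    have hz : ∀ i, ‖z t i - xs‖ ≤ R := fun i => (ht i).1.trans <|
      mul_le_mul_of_nonneg_right
        (pow_le_pow_of_le_one hρ0.le hρ1.le (div_le_updateCount n t i)) hr0
    have hδ : ∀ i, sigma (B t i) (hess (f i) (z t i)) ≤ delta d μ L Lt ρ ε σ₀ := by
      intro i
      have h1 := (ht i).2.2.trans (errBound_le hμ hLt hρ0 hρ1 hρ hε0 hσ₀ _)
      have h2 := sigma_nonneg (posDef_of_le (isHermitian_hess (hf i) (z t i)) hμ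
        (le_dotProduct_hess (hf i) (hsc i) _)) (ht i).2.1
      have h3 : 0 ≤ delta d μ L Lt ρ ε σ₀ := by
        have := h2.trans h1
        exact nonneg_of_mul_nonneg_right this (pow_pos ha0 _)
      exact h1.trans (mul_le_of_le_one_left h3 (pow_le_one₀ ha0.le ha1))
    -- Each residual is at most ρμR by the choice of ε; dividing by μ leaves ρR, which is one more
    -- power of ρ.
    have hmain := norm_newIterate_sub_le (f := f) (z := z t) (B := B t) (c := ρ * μ * R) hμ
      (fun i => isHermitian_of_sub (ht i).2.1 (isHermitian_hess (hf i) _))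
      (fun i => le_dotProduct_of_sub (ht i).2.1 (le_dotProduct_hess (hf i) (hsc i) _)) hgrad
      (fun i => (norm_residual_le hμ (hf i) (hsc i) (hsm i) (hLip i) (ht i).2.1).trans <|
        mul_le_mul ((add_le_add (mul_le_mul_of_nonneg_left (hδ i) hL.le)
          (mul_le_mul_of_nonneg_left ((hz i).trans hRε) (by positivity))).trans hε) (hz i)
          (norm_nonneg _) (by positivity))
    refine hmain.trans_eq ?_
    rw [hR, pow_succ]
    field_simp
  suffices h : ∀ i, ‖z t i - xs‖ ≤ ρ ^ updateCount n t i * ‖x 0 - xs‖ ∧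
      (B t i - hess (f i) (z t i)).PosSemidef ∧
      sigma (B t i) (hess (f i) (z t i)) ≤
        errBound (1 - μ / (d * L)) ρ (4 * concM μ Lt * √L * ε) d σ₀ (updateCount n t i) from
    ⟨h, next t h⟩
  induction t with
  | zero =>
    intro i
    rw [updateCount_zero i.isLt, hrun.init_z]
    exact ⟨by simp, hrun.init_B i, by simpa [errBound] using hσ i⟩
  | succ t ih =>
    intro i
    rcases eq_or_ne i (idx n (t + 1)) with rfl | hi
    · obtain ⟨Q, u, hQ, hu, hB⟩ := hrun.step_B t
      have hxt := next t ih
      set i := idx n (t + 1) with hidx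
      have hc : updateCount n t i = t / n := by
        rw [hidx, idx_succ_val, updateCount_mod hn]
      have hc' : updateCount n (t + 1) i = t / n + 1 := by
        rw [hidx, idx_succ_val, updateCount_succ_mod hn]
      obtain ⟨h1, h2, h3⟩ := ih i
      rw [hc] at h1 h3
      rw [hc']
      have hup := update_step hμ hL hLt hd (hf i) (hsc i) (hsm i) (hLip i) h2 hQ hu
      have hz' : z (t + 1) i = x (t + 1) := hrun.step_z t
      rw [← hB] at hup
      refine ⟨hz' ▸ hxt, hup.1, (hup.2 ha0.le).trans
        (errBound_step ha0 hρ0 (by positivity) hd'.le (beta_nonneg hM _ _) hσ₀ _ ?_ h3)⟩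
      -- Both points lie within ρ^(t/n) ε of x⋆. The resulting 2 cancels the 1/2 in β, giving 4β ≤
      -- 4M√L ε ρ^(t/n).
      have h4 : ‖z (t + 1) i - z t i‖ ≤ 2 * (ρ ^ (t / n) * ε) := by
        have e : z (t + 1) i - z t i = (z (t + 1) i - xs) - (z t i - xs) := by abel
        have h5 : ρ ^ (t / n) * ‖x 0 - xs‖ ≤ ρ ^ (t / n) * ε := by gcongr
        have h6 : ρ ^ (t / n + 1) * ‖x 0 - xs‖ ≤ ρ ^ (t / n) * ‖x 0 - xs‖ :=
          mul_le_mul_of_nonneg_right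
            (pow_le_pow_of_le_one hρ0.le hρ1.le (Nat.le_succ _)) hr0
        have h7 := norm_sub_le (z (t + 1) i - xs) (z t i - xs)
        rw [← e] at h7
        rw [hz'] at h7 ⊢
        linarith
      calc 4 * beta (concM μ Lt) (f i) (z t i) (z (t + 1) i)
          ≤ 4 * (concM μ Lt / 2 * (√L * (2 * (ρ ^ (t / n) * ε)))) := by
            unfold beta
            gcongr
            exact (localNorm_le hL.le (hf i) (hsm i) _ _).trans (by gcongr)
        _ = 4 * concM μ Lt * √L * ε * ρ ^ (t / n) := by ring
    · have hi' : i.val ≠ t % n := by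
        rw [← idx_succ_val]
        exact fun h => hi (Fin.ext h)
      rw [hrun.step_z_other t i hi, hrun.step_B_other t i hi, updateCount_succ_of_ne i.isLt hi']
      exact ih i

end Convergence
end SIQN

theorem mainTheorem5 (d : ℕ) (hd : 0 < d) (μ L Lt ρ : ℝ) (hμ : 0 < μ)
    (hρ0 : 0 < ρ) (hρ1 : ρ < 1 - μ / (d * L)) :
    ∃ ε : ℝ, 0 < ε ∧ ∃ σ₀ : ℝ, 0 < σ₀ ∧
      ∀ (n : ℕ) [NeZero n] (f : Fin n → SIQN.Vec d → ℝ) (xstar : SIQN.Vec d),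
        (∀ i, ContDiff ℝ 2 (f i)) →
        (∀ i, SIQN.StronglyConvex μ (f i)) →
        (∀ i, SIQN.Smooth L (f i)) →
        (∀ i, SIQN.HessLipschitz Lt (f i)) →
        IsMinOn (fun y => (1 / (n : ℝ)) * ∑ i, f i y) Set.univ xstar →
        ∀ (x : ℕ → SIQN.Vec d) (z : ℕ → Fin n → SIQN.Vec d) (B : ℕ → Fin n → SIQN.Mat d),
          SIQN.IsRun (SIQN.concM μ Lt) f x z B →
          ‖x 0 - xstar‖ ≤ ε →
          (∀ i, SIQN.sigma (B 0 i) (SIQN.hess (f i) (x 0)) ≤ σ₀) →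
          (∀ t : ℕ, ‖x t - xstar‖ ≤ ρ ^ ⌈(t : ℝ) / (n : ℝ)⌉₊ * ‖x 0 - xstar‖) ∧
          (∀ t : ℕ, 1 ≤ t →
            SIQN.sigma (B t (SIQN.idx n t)) (SIQN.hess (f (SIQN.idx n t)) (z t (SIQN.idx n t)))
              ≤ (1 - μ / (d * L)) ^ ⌈(t : ℝ) / (n : ℝ)⌉₊ * SIQN.delta d μ L Lt ρ ε σ₀) := by
  obtain ⟨ε, hε, hball⟩ := SIQN.exists_radius (d := d) (L := L) (Lt := Lt) hμ hρ0
  refine ⟨ε, hε, ε, hε, ?_⟩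
  intro n _ f xstar hf hsc hsm hLip hmin x z B hrun hx hσ
  have hn := Nat.pos_of_neZero n
  have hL : 0 < L := hμ.trans_le ((hsc 0).le_of_smooth hd (hsm 0))
  have hLt := (hLip 0).nonneg hd
  have hρ1' : ρ < 1 := by
    have : 0 ≤ μ / (d * L) := by positivity
    linarith
  have inv := hrun.invariant hd hμ hL hLt hρ0 hρ1 hε.le hball hf hsc hsm hLip hmin hx hσ
  refine ⟨fun t => ?_, fun t ht => ?_⟩
  · rcases t with _ | t
    · simp
    · rw [SIQN.ceil_succ_div hn]
      exact (inv t).2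
  · obtain ⟨t, rfl⟩ := Nat.exists_eq_succ_of_ne_zero (Nat.one_le_iff_ne_zero.mp ht)
    -- The error bound is read after iteration t+1, when the treated component has been updated t/n
    -- + 1 times, which is the ceiling in the statement.
    have h := ((inv (t + 1)).1 (SIQN.idx n (t + 1))).2.2
    rw [SIQN.idx_succ_val, SIQN.updateCount_succ_mod hn] at h
    rw [Nat.succ_eq_add_one, SIQN.ceil_succ_div hn]
    exact h.trans (SIQN.errBound_le hμ hLt hρ0 hρ1' hρ1 hε.le hε.le _)
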